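/- Let $\Theta\subset\mathbb{R}^m$ be compact, and suppose that every non-empty relatively open subset of $\Theta$ has positive Lebesgue measure. Let $\mathcal{Y}\subset\mathbb{R}^d$ be a Borel set, and let $y_1,y_2,\dots$ be i.i.d. $\mathcal{Y}$-valued random variables with distribution $P$. Let $\lambda$ be the Lebesgue density of a probability measure on $\mathcal{Y}$. Let $\rho_0$ be a probability measure on $\Theta$ with an everywhere positive Lebesgue density on $\Theta$, also written $\rho_0$, such that for every $r>0$ there is $C_3(r)>0$ with $|\log\rho_0(\theta_1)-\log\rho_0(\theta_2)|\le C_3(r)\|\theta_1-\theta_2\|$ for all $\theta_1,\theta_2\in\Theta$ with $\|\theta_1\|,\|\theta_2\|<r$. Let $L:\Theta\times\mathcal{Y}\to\mathbb{R}$ be a loss function such that: 1. $L$ is bounded below; 2. there is a function $K$ of $(\|\theta\|,\|y\|)$ with $K(\|\theta\|,\|y\|)\in L^1(\Theta\times\mathcal{Y};\rho_0\otimes P)$ and $L(\theta,y)\le K(\|\theta\|,\|y\|)$ for all $\theta,y$; 3. for every $r>0$ there is $C_1(r,\cdot)>0$ in $L^1(\mathcal{Y};P)$ with $|L(\theta_1,y)-L(\theta_2,y)|\le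 C_1(r,y)\|\theta_1-\theta_2\|$ for all $y$ and all $\|\theta_1\|,\|\theta_2\|<r$; 4. for every $r>0$ there is $C_2(r,\cdot)>0$ in $L^1(\Theta;\rho_0)$ with $|L(\theta,y_1)-L(\theta,y_2)|\le C_2(r,\theta)\|y_1-y_2\|$ for all $\theta$ and all $\|y_1\|,\|y_2\|<r$. Let $R(\theta)=\int L(\theta,y)\,P(dy)$, and suppose that the set of minimizers of $R$ over $\Theta$ is a single point, $\Theta^*=\{\theta^*\}$. Suppose there is $\bar W>0$ such that $C_1(r,\cdot)\,e^{VL(\theta^*,\cdot)}\in L^1(\mathcal{Y};P)$ for every $r>0$ and every $V\in(0,\bar W)$. Fix $W\in(0,\bar W)$. For $n\ge1$ let $R_n(\theta)=\frac1n\sum_{i=1}^n L(\theta,y_i)$. The Gibbs posterior $\hat\rho_n^W$ is the unique minimizer of $\int R_n\,d\rho+\frac1{nW}D_{KL}(\rho\|\rho_0)$ over all probability measures $\rho$ on $\Theta$; explicitly, $$\hat\rho_n^W(d\theta)=\frac{e^{-nWR_n(\theta)}\rho_0(d\theta)}{\int e^{-nWR_n}\,d\rho_0}.$$ Let the Gibbs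 predictive $\hat p_n^W$ and the distribution $\tilde p_{\theta^*}$ on $\mathcal{Y}$ have the Lebesgue densities $$\hat p_n^W(y)=\frac{\int e^{-L(\theta,y)}\,\hat\rho_n^W(d\theta)\,\lambda(y)}{\iint e^{-L(\theta,y')}\lambda(y')\,dy'\,\hat\rho_n^W(d\theta)},\qquad \tilde p_{\theta^*}(y)=\frac{e^{-L(\theta^*,y)}\lambda(y)}{\int e^{-L(\theta^*,y')}\lambda(y')\,dy'}.$$ Then, with probability one, $D_{KL}(P\|\hat p_n^W)$ is finite for every $n\ge1$ if $D_{KL}(P\|\tilde p_{\theta^*})$ is finite and infinite for every $n\ge1$ if it is infinite, and in the finite case $$D_{KL}(P\|\hat p_n^W)-D_{KL}(P\|\tilde p_{\theta^*})\to0\quad\text{as } n\to\infty.$$ -/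

import Mathlib

open MeasureTheory ProbabilityTheory Filter Topology

-- `volume` on a subset of a Euclidean space is Lebesgue measure restricted to it
attribute [local instance] MeasureTheory.Measure.Subtype.measureSpace

/-- The average loss `R_n(θ) = (1/n) ∑ i, L(θ, y_i)` over the data `y = (y_1, …, y_n)`. -/
noncomputable def empiricalRisk {T S : Type*} (L : T → S → ℝ) {n : ℕ} (y : Fin n → S) (θ : T) : ℝ :=
  (1 / (n : ℝ)) * ∑ i, L θ (y i)

/-- The expected loss `R(θ) = ∫ L(θ, y) P(dy)`. -/
noncomputable def expectedRisk {T S : Type*} [MeasurableSpace S] (L : T → S → ℝ) (P : Measure S)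
    (θ : T) : ℝ :=
  ∫ y, L θ y ∂P

/-- The set `Θ*` of minimizers of the expected loss. -/
def riskMinimizers {T S : Type*} [MeasurableSpace S] (L : T → S → ℝ) (P : Measure S) : Set T :=
  {θ | ∀ θ', expectedRisk L P θ ≤ expectedRisk L P θ'}

/-- The Gibbs objective `∫ R_n dρ + (1 / (n W)) D_KL(ρ ‖ ρ₀)`, which is `+∞` where the divergence
is. It is used only where `R_n` is a bounded continuous function on a compact parameter space, so
that the first integral always exists. -/
noncomputable def gibbsObjective {T S : Type*} [MeasurableSpace T] (L : T → S → ℝ) (ρ₀ : Measure T)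
    (W : ℝ) {n : ℕ} (y : Fin n → S) (ρ : Measure T) : EReal :=
  ((∫ θ, empiricalRisk L y θ ∂ρ : ℝ) : EReal)
    + ((InformationTheory.klDiv ρ ρ₀ / ENNReal.ofReal (n * W) : ENNReal) : EReal)

/-- The Gibbs posterior `exp(-n W R_n(θ)) ρ₀(dθ) / Z`, with `Z = ∫ exp(-n W R_n) dρ₀`
(`μ.tilted f` is the measure with density `exp f / ∫ exp f dμ` with respect to `μ`). -/
noncomputable def gibbsPosterior {T S : Type*} [MeasurableSpace T] (L : T → S → ℝ) (ρ₀ : Measure T)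
    (W : ℝ) {n : ℕ} (y : Fin n → S) : Measure T :=
  ρ₀.tilted (fun θ => -((n : ℝ) * W * empiricalRisk L y θ))

/-- `lam` is the Lebesgue density of a probability measure on `S`. -/
structure IsProbDensity {S : Type*} [MeasureSpace S] (lam : S → ℝ) : Prop where
  measurable : Measurable lam
  nonneg : ∀ y, 0 ≤ lam y
  lintegral_eq_one : ∫⁻ y, ENNReal.ofReal (lam y) = 1

/-- The Lebesgue density of the Gibbs predictive distribution formed from a distribution `ρ` on the
parameter space:
`∫ exp(-L(θ, y)) ρ(dθ) λ(y) / ∬ exp(-L(θ, y')) λ(y') dy' ρ(dθ)`. -/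
noncomputable def predictiveDensity {T S : Type*} [MeasurableSpace T] [MeasureSpace S]
    (L : T → S → ℝ) (lam : S → ℝ) (ρ : Measure T) (y : S) : ℝ :=
  (∫ θ, Real.exp (-L θ y) ∂ρ) * lam y / ∫ θ, (∫ y', Real.exp (-L θ y') * lam y') ∂ρ

/-- The Gibbs predictive distribution after observing the data `y`. -/
noncomputable def gibbsPredictive {T S : Type*} [MeasurableSpace T] [MeasureSpace S]
    (L : T → S → ℝ) (ρ₀ : Measure T) (lam : S → ℝ) (W : ℝ) {n : ℕ} (y : Fin n → S) : Measure S :=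
  volume.withDensity
    (fun z => ENNReal.ofReal (predictiveDensity L lam (gibbsPosterior L ρ₀ W y) z))

/-- The distribution on the observation space with Lebesgue density
`exp(-L(θ, y)) λ(y) / ∫ exp(-L(θ, y')) λ(y') dy'`. -/
noncomputable def pointPredictive {T S : Type*} [MeasureSpace S]
    (L : T → S → ℝ) (lam : S → ℝ) (θ : T) : Measure S :=
  volume.withDensity (fun z =>
    ENNReal.ofReal (Real.exp (-L θ z) * lam z / ∫ y', Real.exp (-L θ y') * lam y'))

/-- The regularity assumptions on the loss; `C₁ r y` is the local Lipschitz constant in the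
parameter. -/
structure RegularLoss {m d : ℕ} {Θ : Set (EuclideanSpace ℝ (Fin m))}
    {𝒴 : Set (EuclideanSpace ℝ (Fin d))} (L : Θ → 𝒴 → ℝ) (ρ₀ : Measure Θ) (P : Measure 𝒴)
    (C₁ : ℝ → 𝒴 → ℝ) : Prop where
  bounded_below : ∃ B : ℝ, ∀ θ y, B ≤ L θ y
  upper_bound : ∃ K : ℝ → ℝ → ℝ,
    Integrable (fun p : Θ × 𝒴 => K ‖(p.1 : EuclideanSpace ℝ (Fin m))‖
      ‖(p.2 : EuclideanSpace ℝ (Fin d))‖) (ρ₀.prod P) ∧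
    ∀ (θ : Θ) (y : 𝒴), L θ y ≤ K ‖(θ : EuclideanSpace ℝ (Fin m))‖ ‖(y : EuclideanSpace ℝ (Fin d))‖
  lipschitz_param_pos : ∀ r > 0, ∀ y, 0 < C₁ r y
  lipschitz_param : ∀ r > 0, ∀ (y : 𝒴) (θ₁ θ₂ : Θ),
    ‖(θ₁ : EuclideanSpace ℝ (Fin m))‖ < r → ‖(θ₂ : EuclideanSpace ℝ (Fin m))‖ < r →
    |L θ₁ y - L θ₂ y| ≤ C₁ r y * ‖(θ₁ : EuclideanSpace ℝ (Fin m)) - θ₂‖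
  lipschitz_param_integrable : ∀ r > 0, Integrable (C₁ r) P
  lipschitz_data : ∀ r > 0, ∃ C₂ : Θ → ℝ, (∀ θ, 0 < C₂ θ) ∧ Integrable C₂ ρ₀ ∧
    ∀ (θ : Θ) (y₁ y₂ : 𝒴),
      ‖(y₁ : EuclideanSpace ℝ (Fin d))‖ < r → ‖(y₂ : EuclideanSpace ℝ (Fin d))‖ < r →
      |L θ y₁ - L θ y₂| ≤ C₂ θ * ‖(y₁ : EuclideanSpace ℝ (Fin d)) - y₂‖

/-- The prior is a probability measure with an everywhere positive Lebesgue density on `Θ` whose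
logarithm is Lipschitz on bounded sets. -/
def RegularPrior {m : ℕ} {Θ : Set (EuclideanSpace ℝ (Fin m))} (ρ₀ : Measure Θ) : Prop :=
  IsProbabilityMeasure ρ₀ ∧ ∃ q : Θ → ℝ, (∀ θ, 0 < q θ) ∧
    ρ₀ = volume.withDensity (fun θ => ENNReal.ofReal (q θ)) ∧
    ∀ r > 0, ∃ C₃ > 0, ∀ θ₁ θ₂ : Θ,
      ‖(θ₁ : EuclideanSpace ℝ (Fin m))‖ < r → ‖(θ₂ : EuclideanSpace ℝ (Fin m))‖ < r →
      |Real.log (q θ₁) - Real.log (q θ₂)| ≤ C₃ * ‖(θ₁ : EuclideanSpace ℝ (Fin m)) - θ₂‖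

/-! Write `g` for the logarithm of the mixture `∫ exp(-L(θ, y)) ρ(dθ)` plus `L(θ*, y)`. The
predictive density built from `ρ` is the exponential tilt of the point predictive at `θ*` by `g`.
Tilting the second argument of a divergence by a `P`-integrable `f` changes it by exactly `-∫ f dP +
log ∫ exp f dν`, and preserves finiteness in both directions. On a compact `Θ` inside the ball of
radius `r`, the Lipschitz bound gives `|g(y)| ≤ C₁(r, y) diam Θ`. This is `P`-integrable uniformly
in `ρ`, so the two divergences are finite or infinite together for every `n`.

The convergence then needs only that the posteriors concentrate at `θ*`: `g` tends to `0` pointwise,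
and both correction terms vanish by dominated convergence
(`tendsto_toReal_klDiv_predictiveDensity_sub`). Concentration is Laplace's principle
(`tendsto_integral_tilted_of_tendstoUniformly`), fed by the uniform law of large numbers
(`ae_tendstoUniformly_empiricalRisk`). Uniform convergence of the risks is a single almost sure
event that serves all test functions, hence all `y`, at once.

The same tilting formula, with the prior as base measure, gives the variational characterization of
the posterior. -/

/-! ### Relative entropy under exponential tilting of the second argument. -/

section Divergence

variable {α : Type*} [MeasurableSpace α] {P ν : Measure α} [IsProbabilityMeasure P]
  [IsProbabilityMeasure ν] {f : α → ℝ}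

open InformationTheory

lemma klDiv_tilted_right_ne_top (hf : Integrable f P) (hexp : Integrable (fun x => Real.exp (f x)) ν)
    (h : klDiv P ν ≠ ⊤) : klDiv P (ν.tilted f) ≠ ⊤ := by
  rw [klDiv_ne_top_iff] at h ⊢
  exact ⟨h.1.trans (absolutelyContinuous_tilted hexp),
    integrable_llr_tilted_right h.1 hf h.2 hexp⟩

/-- A tilt by `f` is undone by a tilt by `-f`, so the one-sided statement applies in both
directions. -/
lemma klDiv_tilted_right_eq_top_iff (hf : Integrable f P)
    (hexp : Integrable (fun x => Real.exp (f x)) ν) :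
    klDiv P (ν.tilted f) = ⊤ ↔ klDiv P ν = ⊤ := by
  refine not_iff_not.mp ⟨fun h => ?_, klDiv_tilted_right_ne_top hf hexp⟩
  have := isProbabilityMeasure_tilted hexp
  have hneg : Integrable (fun x => Real.exp ((-f) x)) (ν.tilted f) := by
    rw [integrable_tilted_iff hexp]
    simp [Real.exp_neg]
  have key := klDiv_tilted_right_ne_top hf.neg hneg h
  rwa [tilted_neg_same hexp] at key

/-- The log-likelihood ratio against the tilt differs by `-f` plus the log normalizer. Equal total
masses make the divergence the plain integral of that ratio. -/
lemma toReal_klDiv_tilted_right (hf : Integrable f P)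
    (hexp : Integrable (fun x => Real.exp (f x)) ν) (h : klDiv P ν ≠ ⊤) :
    (klDiv P (ν.tilted f)).toReal
      = (klDiv P ν).toReal - ∫ x, f x ∂P + Real.log (∫ x, Real.exp (f x) ∂ν) := by
  have := isProbabilityMeasure_tilted hexp
  rw [klDiv_ne_top_iff] at h
  rw [toReal_klDiv_of_measure_eq (h.1.trans (absolutelyContinuous_tilted hexp)) (by simp),
    toReal_klDiv_of_measure_eq h.1 (by simp), integral_llr_tilted_right h.1 hf hexp h.2]

lemma coe_div_ofReal_eq {x : ENNReal} (hx : x ≠ ⊤) {c : ℝ} (hc : 0 < c) :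
    ((x / ENNReal.ofReal c : ENNReal) : EReal) = ((x.toReal / c : ℝ) : EReal) := by
  rw [← EReal.coe_ennreal_toReal, ENNReal.toReal_div, ENNReal.toReal_ofReal hc.le]
  exact ENNReal.div_ne_top hx (by simpa using hc)

end Divergence

/-! ### The Gibbs variational principle. -/

section Variational

lemma continuous_empiricalRisk {T S : Type*} [TopologicalSpace T] {L : T → S → ℝ}
    (hL : ∀ y, Continuous fun θ => L θ y) {n : ℕ}
    (y : Fin n → S) : Continuous (empiricalRisk L y) := by
  unfold empiricalRisk
  exact continuous_const.mul (continuous_finsetSum _ fun i _ => hL (y i))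

variable {T S : Type*} [TopologicalSpace T] [CompactSpace T] [MeasurableSpace T] [BorelSpace T]

lemma integrable_of_continuous_of_compactSpace {f : T → ℝ} (hf : Continuous f) (ρ : Measure T)
    [IsFiniteMeasure ρ] : Integrable f ρ :=
  hf.integrable_of_hasCompactSupport (HasCompactSupport.of_compactSpace f)

variable {L : T → S → ℝ} {ρ₀ : Measure T} [IsProbabilityMeasure ρ₀] {W : ℝ} {n : ℕ}

lemma integrable_exp_empiricalRisk (hL : ∀ y, Continuous fun θ => L θ y) (y : Fin n → S) :
    Integrable (fun θ => Real.exp (-((n : ℝ) * W * empiricalRisk L y θ))) ρ₀ :=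
  integrable_of_continuous_of_compactSpace
    (Real.continuous_exp.comp (continuous_const.mul (continuous_empiricalRisk hL y)).neg) _

lemma isProbabilityMeasure_gibbsPosterior (hL : ∀ y, Continuous fun θ => L θ y) (y : Fin n → S) :
    IsProbabilityMeasure (gibbsPosterior L ρ₀ W y) :=
  isProbabilityMeasure_tilted (integrable_exp_empiricalRisk hL y)

open InformationTheory in
-- Completing the divergence: `ρ` enters only through its divergence from the posterior, which
-- vanishes at the posterior alone.
lemma gibbsObjective_eq (hL : ∀ y, Continuous fun θ => L θ y) (hW : 0 < W) (hn : 1 ≤ n)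
    (y : Fin n → S) (ρ : Measure T) [IsProbabilityMeasure ρ] (hρ : klDiv ρ ρ₀ ≠ ⊤) :
    gibbsObjective L ρ₀ W y ρ = (((klDiv ρ (gibbsPosterior L ρ₀ W y)).toReal
      - Real.log (∫ θ, Real.exp (-((n : ℝ) * W * empiricalRisk L y θ)) ∂ρ₀)) / (n * W) : ℝ) := by
  have hc : 0 < (n : ℝ) * W := mul_pos (by exact_mod_cast hn) hW
  have hint : Integrable (fun θ => -((n : ℝ) * W * empiricalRisk L y θ)) ρ :=
    integrable_of_continuous_of_compactSpace
      (continuous_const.mul (continuous_empiricalRisk hL y)).neg _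
  rw [gibbsObjective, coe_div_ofReal_eq hρ hc, ← EReal.coe_add, gibbsPosterior,
    toReal_klDiv_tilted_right hint (integrable_exp_empiricalRisk hL y) hρ, integral_neg,
    integral_const_mul]
  congr 1
  field_simp
  ring

open InformationTheory in
lemma gibbsObjective_gibbsPosterior_lt (hL : ∀ y, Continuous fun θ => L θ y) (hW : 0 < W)
    (hn : 1 ≤ n) (y : Fin n → S) (ρ : Measure T) [IsProbabilityMeasure ρ]
    (hne : ρ ≠ gibbsPosterior L ρ₀ W y) :
    gibbsObjective L ρ₀ W y (gibbsPosterior L ρ₀ W y) < gibbsObjective L ρ₀ W y ρ := by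
  have hc : 0 < (n : ℝ) * W := mul_pos (by exact_mod_cast hn) hW
  have := isProbabilityMeasure_gibbsPosterior (ρ₀ := ρ₀) (W := W) hL y
  have hint (ρ : Measure T) [IsProbabilityMeasure ρ] :
      Integrable (fun θ => -((n : ℝ) * W * empiricalRisk L y θ)) ρ :=
    integrable_of_continuous_of_compactSpace
      (continuous_const.mul (continuous_empiricalRisk hL y)).neg _
  have hiff (ρ : Measure T) [IsProbabilityMeasure ρ] :
      klDiv ρ (gibbsPosterior L ρ₀ W y) = ⊤ ↔ klDiv ρ ρ₀ = ⊤ :=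
    klDiv_tilted_right_eq_top_iff (hint ρ) (integrable_exp_empiricalRisk hL y)
  -- Finiteness relative to the prior is read off from the zero divergence of the posterior from
  -- itself.
  have hpost : klDiv (gibbsPosterior L ρ₀ W y) ρ₀ ≠ ⊤ := by
    rw [Ne, ← hiff, klDiv_self]
    simp
  rw [gibbsObjective_eq hL hW hn y _ hpost]
  by_cases hρ : klDiv ρ ρ₀ = ⊤
  · rw [gibbsObjective, hρ, ENNReal.top_div_of_ne_top ENNReal.ofReal_ne_top, EReal.coe_ennreal_top,
      EReal.coe_add_top]
    exact EReal.coe_lt_top _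
  · rw [gibbsObjective_eq hL hW hn y _ hρ, EReal.coe_lt_coe_iff, klDiv_self]
    have hpos : 0 < (klDiv ρ (gibbsPosterior L ρ₀ W y)).toReal :=
      ENNReal.toReal_pos (by rwa [Ne, klDiv_eq_zero_iff]) (by rwa [Ne, hiff])
    simp only [ENNReal.toReal_zero]
    gcongr

end Variational

/-! ### Uniform convergence and Laplace's principle. -/

section Concentration

variable {T : Type*} [PseudoMetricSpace T] [CompactSpace T]

/-- A finite net drawn from `D` carries the pointwise limits; the Lipschitz bounds, eventually with
the common constant `|C| + 1`, spread them to all of `T`. The three errors total less than `ε`. -/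
lemma tendstoUniformly_of_lipschitz_of_dense {F : ℕ → T → ℝ} {G : T → ℝ} {c : ℕ → ℝ} {C : ℝ}
    (hF : ∀ n x y, |F n x - F n y| ≤ c n * dist x y) (hc : Tendsto c atTop (𝓝 C))
    (hG : ∀ x y, |G x - G y| ≤ C * dist x y) {D : Set T} (hD : Dense D)
    (hlim : ∀ x ∈ D, Tendsto (fun n => F n x) atTop (𝓝 (G x))) :
    TendstoUniformly F G atTop := by
  rw [Metric.tendstoUniformly_iff]
  intro ε hε
  set K := |C| + 1 with hK
  have hKpos : 0 < K := by positivity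
  set δ := ε / (4 * K) with hδ
  have hδpos : 0 < δ := by positivity
  obtain ⟨t, htD, htfin, hcover⟩ := isCompact_univ.elim_finite_subcover_image (b := D)
    (c := fun x => Metric.ball x δ) (fun _ _ => Metric.isOpen_ball) (by
      intro x _
      obtain ⟨z, hz, hxz⟩ := Metric.mem_closure_iff.mp (hD x) δ hδpos
      exact Set.mem_iUnion₂.mpr ⟨z, hz, hxz⟩)
  have hnet : ∀ᶠ n in atTop, ∀ x ∈ t, |F n x - G x| < ε / 4 :=
    (eventually_all_finite htfin).mpr fun x hx => by
      simpa [Real.dist_eq] using Metric.tendsto_nhds.mp (hlim x (htD hx)) (ε / 4) (by positivity)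
  have hcK : ∀ᶠ n in atTop, c n < K :=
    hc.eventually_lt_const (lt_of_le_of_lt (le_abs_self C) (by simp [hK]))
  filter_upwards [hnet, hcK] with n hn hcn x
  obtain ⟨z, hz, hxz⟩ := Set.mem_iUnion₂.mp (hcover (Set.mem_univ x))
  rw [Metric.mem_ball] at hxz
  have hKδ : K * δ = ε / 4 := by rw [hδ]; field_simp
  have h1 : |F n x - F n z| ≤ ε / 4 := by
    rw [← hKδ]
    exact (hF n x z).trans (by gcongr)
  have h2 : |G x - G z| ≤ ε / 4 := by
    rw [← hKδ]
    refine (hG x z).trans ?_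
    gcongr
    exact (le_abs_self C).trans (by simp [hK])
  have h3 := hn z hz
  rw [Real.dist_eq]
  rw [abs_lt] at *
  rw [abs_le] at *
  constructor <;> linarith

variable [MeasurableSpace T] [BorelSpace T]

/-- Laplace's principle: the exponential tilts of a measure of full support by `-n W F_n`
concentrate at the minimizer of the uniform limit of `F_n`. -/
lemma tendsto_integral_tilted_of_tendstoUniformly {ρ₀ : Measure T} [IsProbabilityMeasure ρ₀]
    [ρ₀.IsOpenPosMeasure] {F : ℕ → T → ℝ} {G : T → ℝ} (hF : ∀ n, Continuous (F n))
    (hG : Continuous G) (hFG : TendstoUniformly F G atTop) {x₀ : T}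
    (hmin : ∀ x, G x ≤ G x₀ → x = x₀) {W : ℝ} (hW : 0 < W) {f : T → ℝ} (hf : Continuous f) :
    Tendsto (fun n : ℕ => ∫ x, f x ∂(ρ₀.tilted fun x => -((n : ℝ) * W * F n x))) atTop
      (𝓝 (f x₀)) := by
  rw [Metric.tendsto_atTop']
  intro ε hε
  obtain ⟨M, hM⟩ : ∃ M, ∀ x, |f x - f x₀| ≤ M := by
    obtain ⟨M, hM⟩ := isCompact_univ.exists_bound_of_continuousOn
      (hf.sub (continuous_const (y := f x₀))).continuousOn
    exact ⟨M, fun x => hM x (Set.mem_univ x)⟩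
  have hM0 : 0 ≤ M := (abs_nonneg _).trans (hM x₀)
  -- On the compact set where `f` is far from `f x₀`, `G` exceeds its minimum by a gap `4η`. Once `F
  -- n` is within `η` of `G`, it is above `G x₀ + 3η` there and below `G x₀ + 2η` on `V`; the
  -- remaining `η` yields the exponential decay.
  obtain ⟨η, hη, hgap⟩ : ∃ η > 0, ∀ x, ε / 2 ≤ |f x - f x₀| → G x₀ + 4 * η ≤ G x := by
    set A := {x | ε / 2 ≤ |f x - f x₀|} with hA
    have hAc : IsCompact A :=
      (isClosed_le continuous_const (hf.sub continuous_const).abs).isCompact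
    rcases A.eq_empty_or_nonempty with h | h
    · refine ⟨1, one_pos, fun x hx => ?_⟩
      have : x ∈ A := hx
      simp [h] at this
    · obtain ⟨z, hz, hzmin⟩ := hAc.exists_isMinOn h hG.continuousOn
      have hlt : G x₀ < G z := by
        by_contra! hle
        have hzA : ε / 2 ≤ |f z - f x₀| := hz
        rw [hmin z hle, sub_self, abs_zero] at hzA
        linarith
      refine ⟨(G z - G x₀) / 4, by linarith, fun x hx => ?_⟩
      have : G z ≤ G x := hzmin hx
      linarith
  set V := {x | G x < G x₀ + η} with hV
  have hVo : IsOpen V := isOpen_lt hG continuous_const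
  have hVpos : 0 < ρ₀.real V :=
    ENNReal.toReal_pos (hVo.measure_pos ρ₀ ⟨x₀, by simpa [hV] using hη⟩).ne' (measure_ne_top _ _)
  have hsmall : ∀ᶠ n : ℕ in atTop, M * (Real.exp (-((n : ℝ) * (W * η))) / ρ₀.real V) < ε / 2 := by
    have h0 : Tendsto (fun n : ℕ => M * (Real.exp (-((n : ℝ) * (W * η))) / ρ₀.real V)) atTop
        (𝓝 (M * (0 / ρ₀.real V))) := by
      refine ((Real.tendsto_exp_neg_atTop_nhds_zero.comp ?_).div_const _).const_mul _
      exact tendsto_natCast_atTop_atTop.atTop_mul_const (mul_pos hW hη)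
    rw [zero_div, mul_zero] at h0
    exact h0.eventually_lt_const (by positivity)
  have huni := Metric.tendstoUniformly_iff.mp hFG η hη
  obtain ⟨N, hN⟩ := eventually_atTop.mp (hsmall.and huni)
  refine ⟨N, fun n hn => ?_⟩
  obtain ⟨hs, hu⟩ := hN n hn.le
  have hnW : 0 ≤ (n : ℝ) * W := by positivity
  have hcont : Continuous fun x => Real.exp (-((n : ℝ) * W * F n x)) :=
    Real.continuous_exp.comp (continuous_const.mul (hF n)).neg
  have hexp := integrable_of_continuous_of_compactSpace hcont ρ₀
  have hprob := isProbabilityMeasure_tilted hexp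
  set Z := ∫ x, Real.exp (-((n : ℝ) * W * F n x)) ∂ρ₀ with hZ
  have hZpos : 0 < Z := integral_exp_pos hexp
  have hZlb : Real.exp (-((n : ℝ) * W * (G x₀ + 2 * η))) * ρ₀.real V ≤ Z := by
    calc Real.exp (-((n : ℝ) * W * (G x₀ + 2 * η))) * ρ₀.real V
        = ∫ x in V, Real.exp (-((n : ℝ) * W * (G x₀ + 2 * η))) ∂ρ₀ := by
          rw [setIntegral_const, smul_eq_mul, mul_comm]
      _ ≤ ∫ x in V, Real.exp (-((n : ℝ) * W * F n x)) ∂ρ₀ := by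
          refine setIntegral_mono_on (integrable_const _) hexp.integrableOn hVo.measurableSet
            fun x hx => ?_
          have h1 := hu x
          have h2 : G x < G x₀ + η := hx
          rw [Real.dist_eq, abs_lt] at h1
          gcongr
          linarith
      _ ≤ Z := setIntegral_le_integral hexp (ae_of_all _ fun x => (Real.exp_pos _).le)
  have hint : Integrable f (ρ₀.tilted fun x => -((n : ℝ) * W * F n x)) :=
    integrable_of_continuous_of_compactSpace hf _
  have hdiff : ∫ x, f x ∂(ρ₀.tilted fun x => -((n : ℝ) * W * F n x)) - f x₀
      = ∫ x, (Real.exp (-((n : ℝ) * W * F n x)) / Z) • (f x - f x₀) ∂ρ₀ := by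
    rw [← integral_tilted, integral_sub hint (integrable_const _)]
    simp
  have hwint : ∫ x, Real.exp (-((n : ℝ) * W * F n x)) / Z ∂ρ₀ = 1 := by
    rw [integral_div, div_self hZpos.ne']
  -- Where `f` is near `f x₀` the first term suffices, and its weights integrate to one; elsewhere
  -- the normalized weight is at most `exp(-nWη) / ρ₀(V)`.
  have hpt : ∀ x, ‖(Real.exp (-((n : ℝ) * W * F n x)) / Z) • (f x - f x₀)‖
      ≤ Real.exp (-((n : ℝ) * W * F n x)) / Z * (ε / 2)
        + M * (Real.exp (-((n : ℝ) * (W * η))) / ρ₀.real V) := by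
    intro x
    have hw : 0 ≤ Real.exp (-((n : ℝ) * W * F n x)) / Z := by positivity
    rw [norm_smul, Real.norm_eq_abs, Real.norm_eq_abs, abs_of_nonneg hw]
    rcases lt_or_ge (|f x - f x₀|) (ε / 2) with hlt | hge
    · have : 0 ≤ M * (Real.exp (-((n : ℝ) * (W * η))) / ρ₀.real V) := by positivity
      nlinarith
    · have hwle : Real.exp (-((n : ℝ) * W * F n x)) / Z
          ≤ Real.exp (-((n : ℝ) * (W * η))) / ρ₀.real V := by
        rw [div_le_div_iff₀ hZpos hVpos]
        calc Real.exp (-((n : ℝ) * W * F n x)) * ρ₀.real V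
            ≤ Real.exp (-((n : ℝ) * W * (G x₀ + 3 * η))) * ρ₀.real V := by
              have h1 := hu x
              have h2 := hgap x hge
              rw [Real.dist_eq, abs_lt] at h1
              gcongr
              linarith
          _ = Real.exp (-((n : ℝ) * (W * η)))
                * (Real.exp (-((n : ℝ) * W * (G x₀ + 2 * η))) * ρ₀.real V) := by
              rw [← mul_assoc, ← Real.exp_add]
              ring_nf
          _ ≤ Real.exp (-((n : ℝ) * (W * η))) * Z := by gcongr
      have h1 : Real.exp (-((n : ℝ) * W * F n x)) / Z * |f x - f x₀|
          ≤ Real.exp (-((n : ℝ) * (W * η))) / ρ₀.real V * M := by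
        gcongr
        exact hM x
      have h2 : 0 ≤ Real.exp (-((n : ℝ) * W * F n x)) / Z * (ε / 2) := by positivity
      linarith
  rw [Real.dist_eq, hdiff, ← Real.norm_eq_abs]
  have hwi : Integrable (fun x => Real.exp (-((n : ℝ) * W * F n x)) / Z * (ε / 2)) ρ₀ :=
    (hexp.div_const _).mul_const _
  calc _ ≤ ∫ x, (Real.exp (-((n : ℝ) * W * F n x)) / Z * (ε / 2)
        + M * (Real.exp (-((n : ℝ) * (W * η))) / ρ₀.real V)) ∂ρ₀ :=
        norm_integral_le_of_norm_le (hwi.add (integrable_const _)) (ae_of_all _ hpt)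
    _ = ε / 2 + M * (Real.exp (-((n : ℝ) * (W * η))) / ρ₀.real V) := by
        rw [integral_add hwi (integrable_const _), integral_mul_const, hwint]
        simp
    _ < ε := by linarith

end Concentration

/-! ### The strong law for functions of the data. -/

section LargeNumbers

variable {Ω S : Type*} [MeasurableSpace Ω] [MeasurableSpace S] {μ : Measure Ω} {P : Measure S}

lemma ae_tendsto_average_comp {Y : ℕ → Ω → S} (hY : ∀ i, HasLaw (Y i) P μ) (hindep : iIndepFun Y μ)
    {h : S → ℝ} (hh : Integrable h P) :
    ∀ᵐ ω ∂μ, Tendsto (fun n : ℕ => (1 / (n : ℝ)) * ∑ i : Fin n, h (Y i ω)) atTop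
      (𝓝 (∫ y, h y ∂P)) := by
  have hmeas : ∀ i, AEMeasurable h (μ.map (Y i)) := fun i => by
    rw [(hY i).map_eq]
    exact hh.1.aemeasurable
  have hind := hindep.comp₀ (fun _ => h) (fun i => (hY i).aemeasurable) hmeas
  have hid : ∀ i, IdentDistrib (h ∘ Y i) (h ∘ Y 0) μ μ := fun i =>
    IdentDistrib.comp_of_aemeasurable
      ⟨(hY i).aemeasurable, (hY 0).aemeasurable, by rw [(hY i).map_eq, (hY 0).map_eq]⟩ (hmeas i)
  have hint : Integrable (h ∘ Y 0) μ := by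
    rw [← (hY 0).map_eq] at hh
    exact hh.comp_aemeasurable (hY 0).aemeasurable
  have hE : ∫ ω, (h ∘ Y 0) ω ∂μ = ∫ y, h y ∂P := by
    rw [← (hY 0).map_eq, integral_map (hY 0).aemeasurable (hmeas 0).aestronglyMeasurable]
    rfl
  filter_upwards [strong_law_ae_real (fun i => h ∘ Y i) hint
    (fun i j hij => hind.indepFun hij) hid] with ω hω
  rw [hE] at hω
  refine hω.congr fun n => ?_
  rw [Finset.sum_range, div_eq_inv_mul, one_div]
  rfl

end LargeNumbers

/-! ### Predictive distributions as tilts, and convergence of their divergences. -/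

section Predictive

lemma integrable_exp_neg_of_le {α : Type*} [MeasurableSpace α] {ν : Measure α} [IsFiniteMeasure ν]
    {f : α → ℝ} (hf : Measurable f) {B : ℝ} (hB : ∀ x, B ≤ f x) :
    Integrable (fun x => Real.exp (-f x)) ν :=
  Integrable.of_bound (by fun_prop) (Real.exp (-B)) (ae_of_all _ fun x => by
    rw [Real.norm_eq_abs, Real.abs_exp]
    gcongr
    exact hB x)

/-- The mixture `∫ exp(-L(θ, y)) ρ(dθ)` of the unnormalized densities `exp(-L(θ, ·))`. -/
noncomputable def expLossMixture {T S : Type*} [MeasurableSpace T] (L : T → S → ℝ) (ρ : Measure T) (y : S) : ℝ :=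
  ∫ θ, Real.exp (-L θ y) ∂ρ

lemma expLossMixture_le {T S : Type*} [MeasurableSpace T] {L : T → S → ℝ} {B : ℝ}
    {ρ : Measure T} [IsProbabilityMeasure ρ] (hB : ∀ θ y, B ≤ L θ y) (y : S) :
    expLossMixture L ρ y ≤ Real.exp (-B) := by
  refine (Real.le_norm_self _).trans ((norm_integral_le_of_norm_le_const
    (C := Real.exp (-B)) (ae_of_all _ fun θ => ?_)).trans (by simp))
  rw [Real.norm_eq_abs, Real.abs_exp]
  gcongr
  exact hB θ y

variable {T S : Type*} [MeasurableSpace T] [MeasureSpace S] {lam : S → ℝ}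

/-- The probability measure on `S` with Lebesgue density `lam`. -/
noncomputable def baseMeasure (lam : S → ℝ) : Measure S :=
  volume.withDensity fun z => ENNReal.ofReal (lam z)

lemma IsProbDensity.isProbabilityMeasure_baseMeasure (hlam : IsProbDensity lam) :
    IsProbabilityMeasure (baseMeasure lam) :=
  ⟨by rw [baseMeasure, withDensity_apply _ MeasurableSet.univ, setLIntegral_univ,
    hlam.lintegral_eq_one]⟩

lemma IsProbDensity.integral_baseMeasure (hlam : IsProbDensity lam) (f : S → ℝ) :
    ∫ y, f y ∂(baseMeasure lam) = ∫ y, f y * lam y := by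
  rw [baseMeasure, integral_withDensity_eq_integral_toReal_smul
    hlam.measurable.ennreal_ofReal (ae_of_all _ fun _ => ENNReal.ofReal_lt_top)]
  refine integral_congr_ae (ae_of_all _ fun y => ?_)
  simp only [ENNReal.toReal_ofReal (hlam.nonneg y), smul_eq_mul, mul_comm]

lemma IsProbDensity.withDensity_eq_tilted (hlam : IsProbDensity lam) {f : S → ℝ}
    (hf : Measurable f) :
    volume.withDensity (fun z => ENNReal.ofReal
      (Real.exp (f z) * lam z / ∫ y, Real.exp (f y) * lam y)) = (baseMeasure lam).tilted f := by
  rw [Measure.tilted, hlam.integral_baseMeasure, baseMeasure,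
    ← withDensity_mul _ hlam.measurable.ennreal_ofReal (by fun_prop)]
  congr 1
  ext z
  rw [Pi.mul_apply, ← ENNReal.ofReal_mul (hlam.nonneg z)]
  congr 1
  ring

lemma IsProbDensity.pointPredictive_eq_tilted {T : Type*} (hlam : IsProbDensity lam) {L : T → S → ℝ} {θ : T}
    (hL : Measurable (L θ)) :
    pointPredictive L lam θ = (baseMeasure lam).tilted fun z => -L θ z :=
  hlam.withDensity_eq_tilted hL.neg

variable {L : T → S → ℝ} {B : ℝ} {ρ : Measure T} [IsProbabilityMeasure ρ]

lemma measurable_expLossMixture (hL : Measurable (Function.uncurry L)) :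
    Measurable (expLossMixture L ρ) := by
  have : StronglyMeasurable (fun p : S × T => Real.exp (-L p.2 p.1)) := by
    refine Measurable.stronglyMeasurable ?_
    exact Real.measurable_exp.comp (hL.comp measurable_swap).neg
  exact this.integral_prod_right.measurable

lemma expLossMixture_pos (hL : Measurable (Function.uncurry L)) (hB : ∀ θ y, B ≤ L θ y) (y : S) :
    0 < expLossMixture L ρ y :=
  integral_exp_pos (integrable_exp_neg_of_le (hL.comp measurable_prodMk_right) fun θ => hB θ y)

/-- The mixture is comparable to each of its components up to the oscillation of the loss in the
parameter. -/
lemma abs_log_expLossMixture_add_le (hL : Measurable (Function.uncurry L))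
    (hB : ∀ θ y, B ≤ L θ y) {θ₀ : T} {y : S} {K : ℝ} (hK : ∀ θ, |L θ y - L θ₀ y| ≤ K) :
    |Real.log (expLossMixture L ρ y) + L θ₀ y| ≤ K := by
  have hint : Integrable (fun θ => Real.exp (-L θ y)) ρ :=
    integrable_exp_neg_of_le (hL.comp measurable_prodMk_right) fun θ => hB θ y
  have hpos := expLossMixture_pos (ρ := ρ) hL hB y
  have hlow : Real.exp (-L θ₀ y - K) ≤ expLossMixture L ρ y := by
    calc Real.exp (-L θ₀ y - K) = ∫ _, Real.exp (-L θ₀ y - K) ∂ρ := by simp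
      _ ≤ _ := integral_mono (integrable_const _) hint fun θ => by
        have := (abs_le.mp (hK θ)).2
        simp only
        gcongr
        linarith
  have hup : expLossMixture L ρ y ≤ Real.exp (-L θ₀ y + K) := by
    calc expLossMixture L ρ y ≤ ∫ _, Real.exp (-L θ₀ y + K) ∂ρ :=
        integral_mono hint (integrable_const _) fun θ => by
          have := (abs_le.mp (hK θ)).1
          simp only
          gcongr
          linarith
      _ = _ := by simp
  have h1 := (Real.le_log_iff_exp_le hpos).mpr hlow
  have h2 := (Real.log_le_iff_le_exp hpos).mpr hup
  rw [abs_le]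
  constructor <;> linarith

lemma IsProbDensity.integral_integral_exp_neg (hlam : IsProbDensity lam)
    (hL : Measurable (Function.uncurry L)) (hB : ∀ θ y, B ≤ L θ y) :
    ∫ θ, (∫ y, Real.exp (-L θ y) * lam y) ∂ρ = ∫ y, expLossMixture L ρ y * lam y := by
  have := hlam.isProbabilityMeasure_baseMeasure
  simp_rw [← hlam.integral_baseMeasure]
  exact integral_integral_swap
    (integrable_exp_neg_of_le (f := Function.uncurry L) hL fun p => hB p.1 p.2)

/-- Tilts compose by adding exponents, so the `L θ₀` terms cancel and leave the log mixture. Basing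
the tilt at the point predictive makes the exponent a log ratio, which the oscillation of the loss
controls. -/
lemma IsProbDensity.withDensity_predictiveDensity_eq_tilted (hlam : IsProbDensity lam)
    (hL : Measurable (Function.uncurry L)) (hB : ∀ θ y, B ≤ L θ y) (θ₀ : T) :
    volume.withDensity (fun z => ENNReal.ofReal (predictiveDensity L lam ρ z))
      = (pointPredictive L lam θ₀).tilted
          fun y => Real.log (expLossMixture L ρ y) + L θ₀ y := by
  have := hlam.isProbabilityMeasure_baseMeasure
  have hL₀ : Measurable (L θ₀) := hL.comp measurable_prodMk_left
  have hmix := measurable_expLossMixture (ρ := ρ) hL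
  rw [hlam.pointPredictive_eq_tilted hL₀,
    tilted_tilted (integrable_exp_neg_of_le hL₀ (hB θ₀))]
  have hfun : ((fun z => -L θ₀ z) + fun y => Real.log (expLossMixture L ρ y) + L θ₀ y)
      = fun y => Real.log (expLossMixture L ρ y) := by
    ext y
    simp only [Pi.add_apply]
    ring
  rw [hfun, ← hlam.withDensity_eq_tilted hmix.log]
  simp_rw [Real.exp_log (expLossMixture_pos hL hB _)]
  rw [← hlam.integral_integral_exp_neg hL hB]
  rfl

lemma IsProbDensity.isProbabilityMeasure_pointPredictive (hlam : IsProbDensity lam)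
    (hL : Measurable (Function.uncurry L)) (hB : ∀ θ y, B ≤ L θ y) (θ₀ : T) :
    IsProbabilityMeasure (pointPredictive L lam θ₀) := by
  have := hlam.isProbabilityMeasure_baseMeasure
  have hL₀ : Measurable (L θ₀) := hL.comp measurable_prodMk_left
  rw [hlam.pointPredictive_eq_tilted hL₀]
  exact isProbabilityMeasure_tilted (integrable_exp_neg_of_le hL₀ (hB θ₀))

lemma IsProbDensity.integrable_exp_log_expLossMixture_add (hlam : IsProbDensity lam)
    (hL : Measurable (Function.uncurry L)) (hB : ∀ θ y, B ≤ L θ y) (θ₀ : T) :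
    Integrable (fun y => Real.exp (Real.log (expLossMixture L ρ y) + L θ₀ y))
      (pointPredictive L lam θ₀) := by
  have := hlam.isProbabilityMeasure_baseMeasure
  have hL₀ : Measurable (L θ₀) := hL.comp measurable_prodMk_left
  rw [hlam.pointPredictive_eq_tilted hL₀,
    integrable_tilted_iff (integrable_exp_neg_of_le hL₀ (hB θ₀))]
  have hfun : (fun y => Real.exp (-L θ₀ y) • Real.exp (Real.log (expLossMixture L ρ y) + L θ₀ y))
      = expLossMixture L ρ := by
    ext y
    rw [smul_eq_mul, ← Real.exp_add, neg_add_cancel_comm_assoc,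
      Real.exp_log (expLossMixture_pos hL hB _)]
  rw [hfun]
  exact Integrable.of_bound (measurable_expLossMixture hL).aestronglyMeasurable (Real.exp (-B))
    (ae_of_all _ fun y => by
      rw [Real.norm_eq_abs, abs_of_pos (expLossMixture_pos hL hB _)]
      exact expLossMixture_le hB y)

lemma IsProbDensity.integral_exp_log_expLossMixture_add (hlam : IsProbDensity lam)
    (hL : Measurable (Function.uncurry L)) (hB : ∀ θ y, B ≤ L θ y) (θ₀ : T) :
    ∫ y, Real.exp (Real.log (expLossMixture L ρ y) + L θ₀ y) ∂(pointPredictive L lam θ₀)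
      = (∫ y, expLossMixture L ρ y ∂(baseMeasure lam))
        / ∫ y, Real.exp (-L θ₀ y) ∂(baseMeasure lam) := by
  have hL₀ : Measurable (L θ₀) := hL.comp measurable_prodMk_left
  rw [hlam.pointPredictive_eq_tilted hL₀, integral_exp_tilted]
  congr 1
  refine integral_congr_ae (ae_of_all _ fun y => ?_)
  simp only [Pi.add_apply]
  rw [neg_add_cancel_comm_assoc, Real.exp_log (expLossMixture_pos hL hB _)]

open InformationTheory

variable {P : Measure S} {θ₀ : T} {K : S → ℝ}

lemma integrable_log_expLossMixture_add (hL : Measurable (Function.uncurry L))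
    (hB : ∀ θ y, B ≤ L θ y) (hK : Integrable K P) (hLK : ∀ θ y, |L θ y - L θ₀ y| ≤ K y) :
    Integrable (fun y => Real.log (expLossMixture L ρ y) + L θ₀ y) P := by
  have hL₀ : Measurable (L θ₀) := hL.comp measurable_prodMk_left
  have hmix := measurable_expLossMixture (ρ := ρ) hL
  exact hK.mono' (by fun_prop) (ae_of_all _ fun y =>
    abs_log_expLossMixture_add_le hL hB fun θ => hLK θ y)

lemma IsProbDensity.klDiv_predictiveDensity_eq_top_iff [IsProbabilityMeasure P]
    (hlam : IsProbDensity lam)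
    (hL : Measurable (Function.uncurry L)) (hB : ∀ θ y, B ≤ L θ y) (hK : Integrable K P)
    (hLK : ∀ θ y, |L θ y - L θ₀ y| ≤ K y) :
    klDiv P (volume.withDensity (fun z => ENNReal.ofReal (predictiveDensity L lam ρ z))) = ⊤
      ↔ klDiv P (pointPredictive L lam θ₀) = ⊤ := by
  have := hlam.isProbabilityMeasure_pointPredictive hL hB θ₀
  rw [hlam.withDensity_predictiveDensity_eq_tilted hL hB θ₀]
  exact klDiv_tilted_right_eq_top_iff (integrable_log_expLossMixture_add hL hB hK hLK)
    (hlam.integrable_exp_log_expLossMixture_add hL hB θ₀)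

/-- If mixing distributions `ρ n` concentrate at `θ₀`, then the divergence of the mixtures
converges to the divergence of the predictive at `θ₀`. -/
lemma IsProbDensity.tendsto_toReal_klDiv_predictiveDensity_sub [IsProbabilityMeasure P]
    (hlam : IsProbDensity lam)
    (hL : Measurable (Function.uncurry L)) (hB : ∀ θ y, B ≤ L θ y) (hK : Integrable K P)
    (hLK : ∀ θ y, |L θ y - L θ₀ y| ≤ K y) {ρ : ℕ → Measure T} [∀ n, IsProbabilityMeasure (ρ n)]
    (hρ : ∀ y, Tendsto (fun n => expLossMixture L (ρ n) y) atTop (𝓝 (Real.exp (-L θ₀ y))))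
    (hfin : klDiv P (pointPredictive L lam θ₀) ≠ ⊤) :
    Tendsto (fun n => (klDiv P (volume.withDensity
        (fun z => ENNReal.ofReal (predictiveDensity L lam (ρ n) z)))).toReal
      - (klDiv P (pointPredictive L lam θ₀)).toReal) atTop (𝓝 0) := by
  have := hlam.isProbabilityMeasure_pointPredictive hL hB θ₀
  have := hlam.isProbabilityMeasure_baseMeasure
  have hL₀ : Measurable (L θ₀) := hL.comp measurable_prodMk_left
  have hmix n := measurable_expLossMixture (ρ := ρ n) hL
  have hZpos : 0 < ∫ y, Real.exp (-L θ₀ y) ∂(baseMeasure lam) :=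
    integral_exp_pos (integrable_exp_neg_of_le hL₀ (hB θ₀))
  have heq : ∀ n, (klDiv P (volume.withDensity
        (fun z => ENNReal.ofReal (predictiveDensity L lam (ρ n) z)))).toReal
      - (klDiv P (pointPredictive L lam θ₀)).toReal
      = -(∫ y, (Real.log (expLossMixture L (ρ n) y) + L θ₀ y) ∂P)
        + Real.log ((∫ y, expLossMixture L (ρ n) y ∂(baseMeasure lam))
          / ∫ y, Real.exp (-L θ₀ y) ∂(baseMeasure lam)) := fun n => by
    rw [hlam.withDensity_predictiveDensity_eq_tilted hL hB θ₀, toReal_klDiv_tilted_right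
      (integrable_log_expLossMixture_add hL hB hK hLK)
      (hlam.integrable_exp_log_expLossMixture_add hL hB θ₀) hfin,
      hlam.integral_exp_log_expLossMixture_add hL hB]
    ring
  have hlog : Tendsto (fun n => ∫ y, (Real.log (expLossMixture L (ρ n) y) + L θ₀ y) ∂P) atTop
      (𝓝 (∫ _, 0 ∂P)) := by
    refine tendsto_integral_of_dominated_convergence K (fun n => by fun_prop) hK
      (fun n => ae_of_all _ fun y => abs_log_expLossMixture_add_le hL hB fun θ => hLK θ y)
      (ae_of_all _ fun y => ?_)
    have := ((hρ y).log (Real.exp_pos _).ne').add_const (L θ₀ y)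
    simpa using this
  -- The loss is bounded below by `B`, so the constant `exp(-B)` dominates the mixtures under the
  -- base probability measure.
  have hnorm : Tendsto (fun n => ∫ y, expLossMixture L (ρ n) y ∂(baseMeasure lam)) atTop
      (𝓝 (∫ y, Real.exp (-L θ₀ y) ∂(baseMeasure lam))) := by
    refine tendsto_integral_of_dominated_convergence (fun _ => Real.exp (-B))
      (fun n => (hmix n).aestronglyMeasurable) (integrable_const _)
      (fun n => ae_of_all _ fun y => ?_) (ae_of_all _ hρ)
    rw [Real.norm_eq_abs, abs_of_pos (expLossMixture_pos hL hB _)]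
    exact expLossMixture_le hB y
  have hratio := ((hnorm.div_const (∫ y, Real.exp (-L θ₀ y) ∂(baseMeasure lam))).log
    (div_pos hZpos hZpos).ne')
  simp_rw [heq]
  simpa [div_self hZpos.ne'] using hlog.neg.add hratio

end Predictive

/-! ### Uniform law of large numbers for the empirical risk. -/

section Consistency

lemma abs_empiricalRisk_sub_le {T S : Type*} [PseudoMetricSpace T] {L : T → S → ℝ} {C : S → ℝ}
    (hLC : ∀ y θ θ', |L θ y - L θ' y| ≤ C y * dist θ θ') {n : ℕ}
    (y : Fin n → S) (θ θ' : T) :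
    |empiricalRisk L y θ - empiricalRisk L y θ'|
      ≤ ((1 / (n : ℝ)) * ∑ i, C (y i)) * dist θ θ' := by
  rw [empiricalRisk, empiricalRisk, ← mul_sub, ← Finset.sum_sub_distrib, abs_mul,
    abs_of_nonneg (by positivity), mul_assoc, Finset.sum_mul]
  gcongr
  exact (Finset.abs_sum_le_sum_abs _ _).trans (Finset.sum_le_sum fun i _ => hLC _ _ _)

variable {T S Ω : Type*} [PseudoMetricSpace T] [MeasurableSpace S]
  [MeasurableSpace Ω] {P : Measure S} {μ : Measure Ω} {L : T → S → ℝ} {C : S → ℝ}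

lemma abs_expectedRisk_sub_le (hC : Integrable C P) (hL : ∀ θ, Integrable (L θ) P)
    (hLC : ∀ y θ θ', |L θ y - L θ' y| ≤ C y * dist θ θ') (θ θ' : T) :
    |expectedRisk L P θ - expectedRisk L P θ'| ≤ (∫ y, C y ∂P) * dist θ θ' := by
  rw [expectedRisk, expectedRisk, ← integral_sub (hL θ) (hL θ'), ← integral_mul_const,
    ← Real.norm_eq_abs]
  exact norm_integral_le_of_norm_le (hC.mul_const _) (ae_of_all _ fun y => hLC y θ θ')

/-- A uniform law of large numbers for losses that are Lipschitz in the parameter. -/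
lemma ae_tendstoUniformly_empiricalRisk [CompactSpace T] {Y : ℕ → Ω → S} (hY : ∀ i, HasLaw (Y i) P μ)
    (hindep : iIndepFun Y μ) (hC : Integrable C P) (hL : ∀ θ, Integrable (L θ) P)
    (hLC : ∀ y θ θ', |L θ y - L θ' y| ≤ C y * dist θ θ') :
    ∀ᵐ ω ∂μ, TendstoUniformly (fun n : ℕ => empiricalRisk L fun i : Fin n => Y i ω)
      (expectedRisk L P) atTop := by
  -- Countability of `D` leaves a single null set. The law of large numbers for `C` itself controls
  -- the random Lipschitz constants.
  obtain ⟨D, hDc, hD⟩ := TopologicalSpace.exists_countable_dense T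
  have hlim : ∀ᵐ ω ∂μ, ∀ θ ∈ D, Tendsto
      (fun n : ℕ => (1 / (n : ℝ)) * ∑ i : Fin n, L θ (Y i ω)) atTop (𝓝 (∫ y, L θ y ∂P)) :=
    (ae_ball_iff hDc).mpr fun θ _ => ae_tendsto_average_comp hY hindep (hL θ)
  filter_upwards [hlim, ae_tendsto_average_comp hY hindep hC] with ω hω hωC
  exact tendstoUniformly_of_lipschitz_of_dense
    (fun n => abs_empiricalRisk_sub_le hLC fun i : Fin n => Y i ω) hωC
    (abs_expectedRisk_sub_le hC hL hLC) hD hω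

end Consistency

/-! ### Consequences of the assumptions on loss and prior. -/

section Regularity

variable {m d : ℕ} {Θ : Set (EuclideanSpace ℝ (Fin m))} {𝒴 : Set (EuclideanSpace ℝ (Fin d))}
  {ρ₀ : Measure Θ} {P : Measure 𝒴} {L : Θ → 𝒴 → ℝ} {C₁ : ℝ → 𝒴 → ℝ}

lemma continuous_of_abs_sub_le_of_norm_lt {E : Type*} [SeminormedAddCommGroup E] {A : Set E}
    {f : A → ℝ} (hf : ∀ r > 0, ∃ C, ∀ x y : A, ‖(x : E)‖ < r → ‖(y : E)‖ < r →
      |f x - f y| ≤ C * ‖(x : E) - y‖) : Continuous f := by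
  rw [continuous_iff_continuousAt]
  intro x
  obtain ⟨C, hC⟩ := hf (‖(x : E)‖ + 1) (by positivity)
  refine tendsto_iff_dist_tendsto_zero.mpr ?_
  have hlim : Tendsto (fun y : A => C * ‖(y : E) - x‖) (𝓝 x) (𝓝 (C * ‖(x : E) - x‖)) :=
    Continuous.tendsto (by fun_prop) x
  rw [sub_self, norm_zero, mul_zero] at hlim
  have hnear : ∀ᶠ y : A in 𝓝 x, ‖(y : E)‖ < ‖(x : E)‖ + 1 :=
    (Continuous.tendsto (f := fun y : A => ‖(y : E)‖) (by fun_prop) x).eventually_lt_const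
      (lt_add_one _)
  refine squeeze_zero' (Eventually.of_forall fun _ => dist_nonneg) ?_ hlim
  filter_upwards [hnear] with y hy
  rw [Real.dist_eq]
  exact hC y x hy (lt_add_one _)

lemma RegularLoss.continuous_data (hL : RegularLoss L ρ₀ P C₁) (θ : Θ) : Continuous (L θ) := by
  refine continuous_of_abs_sub_le_of_norm_lt fun r hr => ?_
  obtain ⟨C₂, -, -, h⟩ := hL.lipschitz_data r hr
  exact ⟨C₂ θ, h θ⟩

lemma RegularLoss.continuous_param (hL : RegularLoss L ρ₀ P C₁) (y : 𝒴) :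
    Continuous fun θ => L θ y :=
  continuous_of_abs_sub_le_of_norm_lt fun r hr => ⟨C₁ r y, hL.lipschitz_param r hr y⟩

/-- The loss is a Carathéodory function: continuous in the parameter and measurable in the data. -/
lemma RegularLoss.measurable_uncurry (hL : RegularLoss L ρ₀ P C₁) :
    Measurable (Function.uncurry L) :=
  measurable_uncurry_of_continuous_of_measurable hL.continuous_param
    fun θ => (hL.continuous_data θ).measurable

/-- By Fubini the envelope `K` is integrable in `y` for almost every parameter. One such parameter
is enough, since the Lipschitz bound transfers integrability to every other. -/
lemma RegularLoss.integrable [IsProbabilityMeasure ρ₀] [IsProbabilityMeasure P]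
    (hL : RegularLoss L ρ₀ P C₁) {C : 𝒴 → ℝ} (hC : Integrable C P)
    (hLC : ∀ y θ θ', |L θ y - L θ' y| ≤ C y * dist θ θ') (θ : Θ) : Integrable (L θ) P := by
  obtain ⟨B, hB⟩ := hL.bounded_below
  obtain ⟨K, hK, hLK⟩ := hL.upper_bound
  obtain ⟨θ₁, hθ₁⟩ := hK.prod_right_ae.exists
  have h₁ : Integrable (L θ₁) P := by
    refine (hθ₁.abs.add (integrable_const |B|)).mono'
      (hL.continuous_data θ₁).measurable.aestronglyMeasurable (ae_of_all _ fun y => ?_)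
    simp only [Pi.add_apply]
    rw [Real.norm_eq_abs, abs_le]
    have h1 := hB θ₁ y
    have h2 := hLK θ₁ y
    have h3 := neg_abs_le B
    have h4 := le_abs_self (K ‖(θ₁ : EuclideanSpace ℝ (Fin m))‖ ‖(y : EuclideanSpace ℝ (Fin d))‖)
    have h5 := abs_nonneg (K ‖(θ₁ : EuclideanSpace ℝ (Fin m))‖ ‖(y : EuclideanSpace ℝ (Fin d))‖)
    have h6 := abs_nonneg B
    constructor <;> linarith
  have hdiff : Integrable (fun y => L θ y - L θ₁ y) P :=
    (hC.mul_const (dist θ θ₁)).mono' ((hL.continuous_data θ).sub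
      (hL.continuous_data θ₁)).measurable.aestronglyMeasurable (ae_of_all _ fun y => hLC y θ θ₁)
  exact (hdiff.add h₁).congr (ae_of_all _ fun y => by simp)

/-- The density is continuous and positive, so Lebesgue measure is absolutely continuous with
respect to the prior and a set open in `Θ` cannot become null. -/
lemma RegularPrior.isOpenPosMeasure (hρ₀ : RegularPrior ρ₀)
    (hΘ : (volume : Measure Θ).IsOpenPosMeasure) : ρ₀.IsOpenPosMeasure := by
  obtain ⟨-, q, hq, rfl, hlip⟩ := hρ₀
  have hlog : Continuous fun θ => Real.log (q θ) := by
    refine continuous_of_abs_sub_le_of_norm_lt fun r hr => ?_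
    obtain ⟨C₃, -, h⟩ := hlip r hr
    exact ⟨C₃, h⟩
  have hqc : Continuous q := by
    exact (Real.continuous_exp.comp hlog).congr fun θ => Real.exp_log (hq θ)
  exact (withDensity_absolutelyContinuous' hqc.measurable.ennreal_ofReal.aemeasurable
    (ae_of_all _ fun θ => by simpa using hq θ)).isOpenPosMeasure

end Regularity

/-! ### The main theorem. -/

theorem theorem5 {m d : ℕ}
    -- a compact parameter space, of positive Lebesgue measure near each of its points
    (Θ : Set (EuclideanSpace ℝ (Fin m))) (hΘ : IsCompact Θ)
    (hΘpos : (volume : Measure Θ).IsOpenPosMeasure)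
    -- the observation space
    (𝒴 : Set (EuclideanSpace ℝ (Fin d))) (h𝒴 : MeasurableSet 𝒴)
    -- i.i.d. data with distribution `P`
    (P : Measure 𝒴) [IsProbabilityMeasure P]
    {Ω : Type*} [MeasurableSpace Ω] (μ : Measure Ω) [IsProbabilityMeasure μ]
    (Y : ℕ → Ω → 𝒴) (hYlaw : ∀ i, HasLaw (Y i) P μ) (hYindep : iIndepFun Y μ)
    -- prior, loss, and the base density of the predictive
    (ρ₀ : Measure Θ) (hρ₀ : RegularPrior ρ₀)
    (L : Θ → 𝒴 → ℝ) (C₁ : ℝ → 𝒴 → ℝ) (hL : RegularLoss L ρ₀ P C₁)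
    (lam : 𝒴 → ℝ) (hlam : IsProbDensity lam)
    -- the expected loss has exactly one minimizer
    (θstar : Θ) (hθstar : riskMinimizers L P = {θstar})
    -- the tail condition and the admissible range of the regularization parameter
    (Wbar : ℝ)
    (htail : ∀ V : ℝ, 0 < V → V < Wbar → ∀ r > 0,
      Integrable (fun y => C₁ r y * Real.exp (V * L θstar y)) P)
    (W : ℝ) (hW : 0 < W) (hWbar : W < Wbar) :
    -- the Gibbs posterior is the unique minimizer of the Gibbs objective
    (∀ (n : ℕ) (y : Fin n → 𝒴), 1 ≤ n →
      IsProbabilityMeasure (gibbsPosterior L ρ₀ W y) ∧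
      ∀ ρ : Measure Θ, IsProbabilityMeasure ρ → ρ ≠ gibbsPosterior L ρ₀ W y →
        gibbsObjective L ρ₀ W y (gibbsPosterior L ρ₀ W y) < gibbsObjective L ρ₀ W y ρ) ∧
    -- almost sure convergence; the two divergences are finite or infinite together
    ∀ᵐ ω ∂μ,
      (∀ n : ℕ, 1 ≤ n →
        (InformationTheory.klDiv P (gibbsPredictive L ρ₀ lam W (fun i : Fin n => Y i ω)) = ⊤ ↔
          InformationTheory.klDiv P (pointPredictive L lam θstar) = ⊤)) ∧
      (InformationTheory.klDiv P (pointPredictive L lam θstar) ≠ ⊤ →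
        Tendsto (fun n : ℕ =>
          (InformationTheory.klDiv P
            (gibbsPredictive L ρ₀ lam W (fun i : Fin n => Y i ω))).toReal
          - (InformationTheory.klDiv P (pointPredictive L lam θstar)).toReal) atTop (𝓝 0)) := by
  have := isCompact_iff_compactSpace.mp hΘ
  have := hρ₀.1
  have := hρ₀.isOpenPosMeasure hΘpos
  obtain ⟨B, hB⟩ := hL.bounded_below
  -- A single radius `r` covers the compact `Θ`, so `C₁ r` is a global Lipschitz constant in the
  -- parameter.
  obtain ⟨r, hr, hΘr⟩ := hΘ.isBounded.exists_pos_norm_lt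
  have hcont := hL.continuous_param
  have hLm := hL.measurable_uncurry
  have hC := hL.lipschitz_param_integrable r hr
  have hLC : ∀ y θ θ', |L θ y - L θ' y| ≤ C₁ r y * dist θ θ' := fun y θ θ' => by
    rw [Subtype.dist_eq, dist_eq_norm]
    exact hL.lipschitz_param r hr y θ θ' (hΘr θ θ.2) (hΘr θ' θ'.2)
  have hint := hL.integrable hC hLC
  have hosc : ∀ θ y, |L θ y - L θstar y| ≤ C₁ r y * Metric.diam (Set.univ : Set Θ) := fun θ y => by
    refine (hLC y θ θstar).trans (mul_le_mul_of_nonneg_left ?_ (hL.lipschitz_param_pos r hr y).le)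
    exact Metric.dist_le_diam_of_mem isCompact_univ.isBounded (Set.mem_univ _) (Set.mem_univ _)
  have hpost (n : ℕ) (y : Fin n → 𝒴) : IsProbabilityMeasure (gibbsPosterior L ρ₀ W y) :=
    isProbabilityMeasure_gibbsPosterior hcont y
  refine ⟨fun n y hn => ⟨hpost n y, fun ρ hρ hne =>
    gibbsObjective_gibbsPosterior_lt hcont hW hn y ρ hne⟩, ?_⟩
  have hmin : ∀ θ, expectedRisk L P θ ≤ expectedRisk L P θstar → θ = θstar := fun θ hθ => by
    have hstar : θstar ∈ riskMinimizers L P := by simp [hθstar]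
    have hmem : θ ∈ riskMinimizers L P := fun θ' => hθ.trans (hstar θ')
    simpa [hθstar] using hmem
  have hRcont : Continuous (expectedRisk L P) := by
    refine (LipschitzWith.of_dist_le_mul (K := (∫ y, C₁ r y ∂P).toNNReal) fun θ θ' => ?_).continuous
    rw [Real.dist_eq]
    refine (abs_expectedRisk_sub_le hC hint hLC θ θ').trans ?_
    gcongr
    exact Real.le_coe_toNNReal _
  filter_upwards [ae_tendstoUniformly_empiricalRisk hYlaw hYindep hC hint hLC] with ω hω
  refine ⟨fun n _ => hlam.klDiv_predictiveDensity_eq_top_iff hLm hB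
    (hC.mul_const (Metric.diam (Set.univ : Set Θ))) hosc, fun hfin => ?_⟩
  exact hlam.tendsto_toReal_klDiv_predictiveDensity_sub hLm hB
    (hC.mul_const (Metric.diam (Set.univ : Set Θ))) hosc
    (ρ := fun n => gibbsPosterior L ρ₀ W fun i : Fin n => Y i ω)
    -- Laplace's principle with test function `exp(-L(·, y))`; the exceptional set of `ω` does not
    -- depend on `y`.
    (fun y => tendsto_integral_tilted_of_tendstoUniformly
      (fun n => continuous_empiricalRisk hcont fun i : Fin n => Y i ω) hRcont hω hmin hW
      (Real.continuous_exp.comp (hcont y).neg)) hfin
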